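/- Fix the following notation. For $n\ge 1$ and $\mathbf a\in\{0,1,2,3\}^n$ let $P_{\mathbf a}=P_{a_1}\otimes\cdots\otimes P_{a_n}$ be the Pauli strings, where $P_0,P_1,P_2,P_3=\mathbb 1,X,Y,Z$, and let $|\Phi_{\mathbf a}\rangle=(\mathbb 1\otimes P_{\mathbf a})\,2^{-n/2}\sum_{z\in\{0,1\}^n}|z\rangle\otimes|z\rangle$ be the Bell states. For an $n$-qubit state $\rho$ let $q_\rho(\mathbf a)=\langle\Phi_{\mathbf a}|\rho\otimes\rho|\Phi_{\mathbf a}\rangle$ be its Bell distribution. Put $c(\rho,\sigma)=\operatorname{tr}(\rho\sigma)/\sqrt{\operatorname{tr}\rho^2\,\operatorname{tr}\sigma^2}$. The protocol rDIPE with parameters $N_1,N_2\ge 1$ and inputs $\rho,\sigma$ runs as follows. (1) Sample $\mathbf a_1,\dots,\mathbf a_{N_1}$ independently from $(q_\rho+q_\sigma)/2$, i.e. each $\mathbf a_i$ is the outcome of a Bell measurement on $\rho\otimes\rho$ or on $\sigma\otimes\sigma$, with equal probability. (2) For each $i$, measure the observable $P_{\mathbf a_i}$ on $N_2$ copies of $\rho$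 and on $N_2$ copies of $\sigma$, independently, and let $\alpha_i$ and $\beta_i$ be the averages of the respective $N_2$ outcomes in $\{\pm1\}$. (3) Return $$f(\rho,\sigma,N_1,N_2)=\frac1{N_1}\sum_{i=1}^{N_1}\frac{2\alpha_i\beta_i}{\alpha_i^2\sqrt{B/A}+\beta_i^2\sqrt{A/B}},\qquad A=\operatorname{tr}\rho^2,\quad B=\operatorname{tr}\sigma^2,$$ where the purities $A,B$ are taken to be known exactly and a summand with $\alpha_i=\beta_i=0$ is read as $0$. Let $|W_n\rangle=n^{-1/2}\sum_{z\in\{0,1\}^n,\ \sum_i z_i=1}|z\rangle$, and let $\mathrm{CW}(n)$ be the set of pure states $C|W_n\rangle$, where $C$ ranges over the real Clifford unitaries on $n$ qubits, i.e. the unitary matrices with real entries in the computational basis that map the $n$-qubit Pauli group to itself under conjugation. **Proposition.** Let $(\rho_n)_{n\ge1}$ and $(\sigma_n)_{n\ge1}$ be sequences of states with $\rho_n,\sigma_n\in\mathrm{CW}(n)$ for all $n\ge1$. Then rDIPE is efficient on these inputs: there are positive integers $N_1=N_1(n,\epsilon,\delta)$ and $N_2=N_2(n,\epsilon,\delta)$,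 each bounded by a polynomial in $n$, $1/\epsilon$ and $\delta$, such that for all integers $n\ge1$ and all real $\epsilon,\delta>0$ $$\mathbb P\Big\{\big|f(\rho_n,\sigma_n,N_1,N_2)-c(\rho_n,\sigma_n)\big|>\epsilon\Big\}<e^{-\delta},$$ where $\mathbb P$ refers to the randomness of the protocol. -/

import Mathlib

open scoped Kronecker

namespace CrossDevice

noncomputable section

/-- Labels of the computational basis of `n` qubits. -/
abbrev Bits (n : ℕ) := Fin n → Fin 2

/-- Labels of the `n`-qubit Pauli strings. -/
abbrev PauliLabel (n : ℕ) := Fin n → Fin 4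

/-- Operators on `n` qubits, written in the computational basis. -/
abbrev Op (n : ℕ) := Matrix (Bits n) (Bits n) ℂ

/-- The one-qubit Pauli matrices `1, X, Y, Z`. -/
def pauliOne : Fin 4 → Matrix (Fin 2) (Fin 2) ℂ :=
  ![!![1, 0; 0, 1], !![0, 1; 1, 0], !![0, -Complex.I; Complex.I, 0], !![1, 0; 0, -1]]

/-- The Pauli string `P_a`, the tensor product of the one-qubit matrices `P_{a i}`. -/
def pauli {n : ℕ} (a : PauliLabel n) : Op n :=
  Matrix.of fun x y => ∏ i, pauliOne (a i) (x i) (y i)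

/-- The Bell state `Φ_0 = 2^{-n/2} ∑_z |z⟩ ⊗ |z⟩` on two copies of `n` qubits. -/
def bellZero (n : ℕ) : Bits n × Bits n → ℂ :=
  fun p => if p.1 = p.2 then ((1 / Real.sqrt (2 ^ n) : ℝ) : ℂ) else 0

/-- The Bell state `Φ_a = (1 ⊗ P_a) Φ_0`. -/
def bellVec {n : ℕ} (a : PauliLabel n) : Bits n × Bits n → ℂ :=
  ((1 : Op n) ⊗ₖ pauli a).mulVec (bellZero n)

/-- The Bell distribution `q_ρ(a) = ⟨Φ_a| ρ ⊗ ρ |Φ_a⟩`. -/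
def bellDist {n : ℕ} (ρ : Op n) (a : PauliLabel n) : ℝ :=
  (star (bellVec a) ⬝ᵥ (ρ ⊗ₖ ρ).mulVec (bellVec a)).re

/-- The eigenvalue of a Pauli string that a measurement outcome stands for. -/
def outcome (s : Bool) : ℝ := if s then 1 else -1

/-- Probability of the outcome `±1` when the observable `P_a` is measured on one copy of `ρ`:
the trace of `ρ` times the projector `(1 ± P_a) / 2`. -/
def pauliProb {n : ℕ} (ρ : Op n) (a : PauliLabel n) (s : Bool) : ℝ :=
  (Matrix.trace (ρ * ((1 / 2 : ℂ) • (1 + (outcome s : ℂ) • pauli a)))).re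

/-- The purity `tr ρ²`. -/
def purity {n : ℕ} (ρ : Op n) : ℝ := (Matrix.trace (ρ * ρ)).re

/-- `c(ρ, σ) = tr(ρ σ) / √(tr ρ² tr σ²)`. -/
def cosine {n : ℕ} (ρ σ : Op n) : ℝ :=
  (Matrix.trace (ρ * σ)).re / Real.sqrt (purity ρ * purity σ)

/-- The data produced in one round of rDIPE: the sampled Pauli label, the `N₂` outcomes of Alice
and the `N₂` outcomes of Bob. -/
abbrev Round (n N₂ : ℕ) := PauliLabel n × (Fin N₂ → Bool) × (Fin N₂ → Bool)

/-- The data produced in a run of rDIPE with `N₁` rounds. -/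
abbrev Run (n N₁ N₂ : ℕ) := Fin N₁ → Round n N₂

/-- Probability of the data of one round: the label comes from a Bell measurement on `ρ ⊗ ρ` or on
`σ ⊗ σ`, with equal probability; given the label `a`, Alice measures `P_a` on `N₂` copies of `ρ`
and Bob measures `P_a` on `N₂` copies of `σ`, all independently. -/
def roundProb {n : ℕ} (ρ σ : Op n) {N₂ : ℕ} (r : Round n N₂) : ℝ :=
  (bellDist ρ r.1 + bellDist σ r.1) / 2 *
    ((∏ j, pauliProb ρ r.1 (r.2.1 j)) * ∏ j, pauliProb σ r.1 (r.2.2 j))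

/-- Probability of the data of a run; the rounds are independent. -/
def runProb {n : ℕ} (ρ σ : Op n) {N₁ N₂ : ℕ} (ω : Run n N₁ N₂) : ℝ :=
  ∏ i, roundProb ρ σ (ω i)

/-- The estimate of a Pauli expectation value: the average of the measured values. -/
def average {N₂ : ℕ} (s : Fin N₂ → Bool) : ℝ := (∑ j, outcome (s j)) / (N₂ : ℝ)

/-- The output `f(ρ, σ, N₁, N₂)` of rDIPE as a function of the data `ω`, where the purities `A`
and `B` are known exactly. A summand in which both averages vanish is `0`. -/
def estimator {n : ℕ} (ρ σ : Op n) {N₁ N₂ : ℕ} (ω : Run n N₁ N₂) : ℝ :=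
  let A := purity ρ
  let B := purity σ
  (1 / (N₁ : ℝ)) * ∑ i,
    2 * average (ω i).2.1 * average (ω i).2.2 /
      (average (ω i).2.1 ^ 2 * Real.sqrt (B / A) + average (ω i).2.2 ^ 2 * Real.sqrt (A / B))

open Classical in
/-- The probability that rDIPE misses `c(ρ, σ)` by more than `ε`. -/
def failureProb {n : ℕ} (ρ σ : Op n) (N₁ N₂ : ℕ) (ε : ℝ) : ℝ :=
  ∑ ω : Run n N₁ N₂, if ε < |estimator ρ σ ω - cosine ρ σ| then runProb ρ σ ω else 0

/-- `N = poly(n, 1/ε, δ)`: bounded by a polynomial in these three quantities. -/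
def PolyBounded (N : ℕ → ℝ → ℝ → ℕ) : Prop :=
  ∃ p : MvPolynomial (Fin 3) ℝ, ∀ (n : ℕ) (ε δ : ℝ), 0 < n → 0 < ε → 0 < δ →
    (N n ε δ : ℝ) ≤ MvPolynomial.eval ![(n : ℝ), 1 / ε, δ] p

/-- Efficiency of rDIPE on two sequences of states, indexed by the number of qubits `n ≥ 1`. -/
def Efficient (ρ σ : (n : ℕ) → Op n) : Prop :=
  ∃ N₁ N₂ : ℕ → ℝ → ℝ → ℕ, PolyBounded N₁ ∧ PolyBounded N₂ ∧
    ∀ (n : ℕ) (ε δ : ℝ), 0 < n → 0 < ε → 0 < δ →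
      0 < N₁ n ε δ ∧ 0 < N₂ n ε δ ∧
        failureProb (ρ n) (σ n) (N₁ n ε δ) (N₂ n ε δ) ε < Real.exp (-δ)

/-- The real Clifford group: the unitary matrices with real entries that conjugate every Pauli
string to a Pauli string, up to a power of `i`. -/
def realClifford (n : ℕ) : Set (Op n) :=
  {C | C ∈ Matrix.unitaryGroup (Bits n) ℂ ∧ (∀ x y, (C x y).im = 0) ∧
    ∀ a : PauliLabel n, ∃ (k : ℕ) (b : PauliLabel n),
      C * pauli a * C.conjTranspose = Complex.I ^ k • pauli b}

/-- The `n`-qubit W state. -/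
def wState (n : ℕ) : Bits n → ℂ :=
  fun z => if ∑ i, (z i : ℕ) = 1 then ((1 / Real.sqrt n : ℝ) : ℂ) else 0

/-- The state vectors `C |W_n⟩` with `C` a real Clifford unitary. -/
def CW (n : ℕ) : Set (Bits n → ℂ) :=
  {ψ | ∃ C ∈ realClifford n, ψ = C.mulVec (wState n)}

/-- The density operator `|ψ⟩⟨ψ|`. -/
def pureState {n : ℕ} (ψ : Bits n → ℂ) : Op n := Matrix.vecMulVec ψ (star ψ)

end

end CrossDevice

/-! Write `x` and `y` for the expectation values of `P_a` in the two states. A vector in `CW n` is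
real, so its Bell distribution is `x ^ 2 / 2 ^ n` (`bellDist_pureState`), and labels are drawn with
weight `(x ^ 2 + y ^ 2) / 2 ^ (n + 1)`. Averaging `2xy / (x ^ 2 + y ^ 2)` with this weight cancels
the denominator and leaves `∑ xy / 2 ^ n = tr(ρσ)`, which is the cosine because both purities are 1
(`sum_bellDist_mul`).

Two errors remain. The fluctuation over rounds is handled by `chernoff`, since each summand lies in
`[-1, 1]`. The bias comes from replacing `x, y` by empirical means: `2ab / (a ^ 2 + b ^ 2)` is
Lipschitz with constant `2 / r` at distance `r` from the origin (`abs_two_mul_div_sub_le`), so small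
expectation values are the only danger. They do not occur: `n * x` is an integer
(`exists_int_pauliExpect`), so every label of positive probability has `r ≥ 1 / n`. With `M ^ 2`
copies per label the bias is at most `4n / M`. -/

namespace CrossDevice

/-! ### Concentration for product measures on finite sets -/

section FiniteProbability

variable {Ω : Type*} [Fintype Ω]

theorem sum_prod_eq_one {p : Ω → ℝ} (h1 : ∑ x, p x = 1) (N : ℕ) :
    ∑ ω : Fin N → Ω, ∏ i, p (ω i) = 1 := by
  classical
  have h := (Finset.prod_univ_sum (fun _ : Fin N => (Finset.univ : Finset Ω)) (fun _ x => p x)).symm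
  simpa [h1] using h

theorem sum_prod_mul_prod {p : Ω → ℝ} (f : Ω → ℝ) (N : ℕ) :
    ∑ ω : Fin N → Ω, (∏ i, p (ω i)) * ∏ i, f (ω i) = (∑ x, p x * f x) ^ N := by
  classical
  have h := (Finset.prod_univ_sum (fun _ : Fin N => (Finset.univ : Finset Ω))
    (fun _ x => p x * f x)).symm
  simpa [Finset.prod_mul_distrib] using h

/-- The bound `|exp u - 1 - u| ≤ u ^ 2` needs `|u| ≤ 1`, hence `l ≤ 1 / 2` when `|Y| ≤ 2`; the
linear term averages to zero. -/
theorem sum_mul_exp_le {p Y : Ω → ℝ} (hp : ∀ x, 0 ≤ p x) (h1 : ∑ x, p x = 1)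
    (hY : ∀ x, |Y x| ≤ 2) (hm : ∑ x, p x * Y x = 0) {l : ℝ} (hl : 0 ≤ l) (hl' : l ≤ 1 / 2) :
    ∑ x, p x * Real.exp (l * Y x) ≤ Real.exp (4 * l ^ 2) := by
  have key : ∀ x, Real.exp (l * Y x) ≤ 1 + l * Y x + 4 * l ^ 2 := by
    intro x
    have hb : |l * Y x| ≤ 1 := by
      rw [abs_mul, abs_of_nonneg hl]
      nlinarith [hY x, abs_nonneg (Y x)]
    have h := (abs_le.mp (Real.abs_exp_sub_one_sub_id_le hb)).2
    have h4 : Y x ^ 2 ≤ 4 := by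
      have := sq_le_sq' (abs_le.mp (hY x)).1 (abs_le.mp (hY x)).2
      linarith
    nlinarith [mul_le_mul_of_nonneg_left h4 (sq_nonneg l)]
  calc ∑ x, p x * Real.exp (l * Y x)
      ≤ ∑ x, (p x + l * (p x * Y x) + 4 * l ^ 2 * p x) :=
        Finset.sum_le_sum fun x _ => by
          have := mul_le_mul_of_nonneg_left (key x) (hp x)
          linarith
    _ = 4 * l ^ 2 + 1 := by
        rw [Finset.sum_add_distrib, Finset.sum_add_distrib, ← Finset.mul_sum, ← Finset.mul_sum,
          hm, h1]
        ring
    _ ≤ _ := Real.add_one_le_exp _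

/-- A one-sided Chernoff bound for the sum of independent centered variables bounded by `2`. -/
theorem chernoff_upper {p Y : Ω → ℝ} (hp : ∀ x, 0 ≤ p x) (h1 : ∑ x, p x = 1)
    (hY : ∀ x, |Y x| ≤ 2) (hm : ∑ x, p x * Y x = 0) {t : ℝ} (ht : 0 ≤ t) (ht' : t ≤ 1) (N : ℕ)
    (D : (Fin N → Ω) → Prop) [DecidablePred D] (hD : ∀ ω, D ω → N * t ≤ ∑ i, Y (ω i)) :
    ∑ ω : Fin N → Ω, (if D ω then ∏ i, p (ω i) else 0) ≤ Real.exp (-(N * t ^ 2 / 16)) := by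
  -- Markov's inequality for `exp (l * ∑ Y)`; `l = t / 8` minimises `4 * l ^ 2 - l * t`, with value
  -- `-t ^ 2 / 16`.
  calc ∑ ω : Fin N → Ω, (if D ω then ∏ i, p (ω i) else 0)
      ≤ ∑ ω : Fin N → Ω, Real.exp (-(t / 8 * (N * t))) *
          ((∏ i, p (ω i)) * ∏ i, Real.exp (t / 8 * Y (ω i))) := by
        refine Finset.sum_le_sum fun ω _ => ?_
        have hP : 0 ≤ ∏ i, p (ω i) := Finset.prod_nonneg fun i _ => hp _
        split_ifs with h
        · rw [← Real.exp_sum, ← Finset.mul_sum, mul_left_comm, ← Real.exp_add]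
          refine le_mul_of_one_le_right hP (Real.one_le_exp ?_)
          nlinarith [mul_le_mul_of_nonneg_left (hD ω h) ht]
        · positivity
    _ = Real.exp (-(t / 8 * (N * t))) * (∑ x, p x * Real.exp (t / 8 * Y x)) ^ N := by
        rw [← Finset.mul_sum, sum_prod_mul_prod fun x => Real.exp (t / 8 * Y x)]
    _ ≤ Real.exp (-(t / 8 * (N * t))) * Real.exp (4 * (t / 8) ^ 2) ^ N := by
        gcongr
        · exact Finset.sum_nonneg fun x _ => mul_nonneg (hp x) (Real.exp_nonneg _)
        · exact sum_mul_exp_le hp h1 hY hm (by linarith) (by linarith)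
    _ = _ := by
        rw [← Real.exp_nat_mul, ← Real.exp_add]
        ring_nf

/-- A two-sided Chernoff bound for the empirical mean of a variable bounded by `1`. -/
theorem chernoff {p X : Ω → ℝ} (hp : ∀ x, 0 ≤ p x) (h1 : ∑ x, p x = 1)
    (hX : ∀ x, |X x| ≤ 1) {t : ℝ} (ht : 0 ≤ t) (ht' : t ≤ 1) {N : ℕ} (hN : 0 < N)
    (D : (Fin N → Ω) → Prop) [DecidablePred D]
    (hD : ∀ ω, D ω → t ≤ |1 / (N : ℝ) * ∑ i, X (ω i) - ∑ x, p x * X x|) :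
    ∑ ω : Fin N → Ω, (if D ω then ∏ i, p (ω i) else 0) ≤ 2 * Real.exp (-(N * t ^ 2 / 16)) := by
  classical
  set m := ∑ x, p x * X x with hm
  have hmb : |m| ≤ 1 := by
    calc |m| ≤ ∑ x, |p x * X x| := Finset.abs_sum_le_sum_abs _ _
      _ ≤ ∑ x, p x := Finset.sum_le_sum fun x _ => by
          rw [abs_mul, abs_of_nonneg (hp x)]
          exact mul_le_of_le_one_right (hp x) (hX x)
      _ = 1 := h1
  have hsub : ∀ x, |X x - m| ≤ 2 := fun x => (abs_sub _ _).trans (by linarith [hX x])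
  have hmean : ∑ x, p x * (X x - m) = 0 := by
    simp only [mul_sub, Finset.sum_sub_distrib, ← Finset.sum_mul, h1, ← hm]
    ring
  have hN' : (0 : ℝ) < N := by exact_mod_cast hN
  have hu := chernoff_upper hp h1 hsub hmean ht ht' N
    (fun ω => (N : ℝ) * t ≤ ∑ i, (X (ω i) - m)) (fun _ h => h)
  have hl := chernoff_upper (Y := fun x => -(X x - m)) hp h1 (fun x => by rw [abs_neg]; exact hsub x)
    (by simp only [mul_neg, Finset.sum_neg_distrib, hmean, neg_zero]) ht ht' N
    (fun ω => (N : ℝ) * t ≤ ∑ i, -(X (ω i) - m)) (fun _ h => h)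
  rw [two_mul]
  refine le_trans ?_ (add_le_add hu hl)
  rw [← Finset.sum_add_distrib]
  refine Finset.sum_le_sum fun ω _ => ?_
  have hP : 0 ≤ ∏ i, p (ω i) := Finset.prod_nonneg fun i _ => hp _
  by_cases hd : D ω
  · have hs : ∑ i, (X (ω i) - m) = N * (1 / (N : ℝ) * ∑ i, X (ω i) - m) := by
      rw [Finset.sum_sub_distrib, Finset.sum_const, Finset.card_univ, Fintype.card_fin,
        nsmul_eq_mul, mul_sub, ← mul_assoc, mul_one_div_cancel hN'.ne', one_mul]
    rw [if_pos hd]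
    rcases le_abs.mp (hD ω hd) with h | h
    · have : (N : ℝ) * t ≤ ∑ i, (X (ω i) - m) := by
        rw [hs]; exact mul_le_mul_of_nonneg_left h hN'.le
      rw [if_pos this]
      split_ifs <;> linarith
    · have : (N : ℝ) * t ≤ ∑ i, -(X (ω i) - m) := by
        rw [Finset.sum_neg_distrib, hs, ← mul_neg]
        exact mul_le_mul_of_nonneg_left h hN'.le
      rw [if_pos this]
      split_ifs <;> linarith
  · rw [if_neg hd]
    split_ifs <;> linarith

theorem sum_fin_succ_fun {N : ℕ} (F : (Fin (N + 1) → Ω) → ℝ) :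
    ∑ ω, F ω = ∑ x : Ω, ∑ ω : Fin N → Ω, F (Fin.cons x ω) := by
  rw [← Fintype.sum_prod_type']
  exact (Fintype.sum_equiv (Fin.consEquiv fun _ => Ω) _ _ fun _ => rfl).symm

/-- Removes the cross terms when the square in `sum_prod_mul_sum_sq` is expanded one coordinate at a
time. -/
theorem sum_prod_mul_sum {p Y : Ω → ℝ} (h1 : ∑ x, p x = 1) (hm : ∑ x, p x * Y x = 0) (N : ℕ) :
    ∑ ω : Fin N → Ω, (∏ i, p (ω i)) * ∑ i, Y (ω i) = 0 := by
  induction N with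
  | zero => simp
  | succ N ih =>
    rw [sum_fin_succ_fun]
    have h : ∀ x, ∑ ω : Fin N → Ω, (∏ i, p ((Fin.cons x ω : Fin (N + 1) → Ω) i)) *
        ∑ i, Y ((Fin.cons x ω : Fin (N + 1) → Ω) i) = p x * Y x := by
      intro x
      simp only [Fin.prod_univ_succ, Fin.sum_univ_succ, Fin.cons_zero, Fin.cons_succ]
      calc _ = p x * Y x * ∑ ω : Fin N → Ω, ∏ i, p (ω i)
            + p x * ∑ ω : Fin N → Ω, (∏ i, p (ω i)) * ∑ i, Y (ω i) := by
            rw [Finset.mul_sum, Finset.mul_sum, ← Finset.sum_add_distrib]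
            exact Finset.sum_congr rfl fun _ _ => by ring
        _ = _ := by rw [ih, sum_prod_eq_one h1]; ring
    simp only [h, hm]

/-- The variance of a sum of independent centered variables. -/
theorem sum_prod_mul_sum_sq {p Y : Ω → ℝ} (h1 : ∑ x, p x = 1) (hm : ∑ x, p x * Y x = 0) (N : ℕ) :
    ∑ ω : Fin N → Ω, (∏ i, p (ω i)) * (∑ i, Y (ω i)) ^ 2 = N * ∑ x, p x * Y x ^ 2 := by
  induction N with
  | zero => simp
  | succ N ih =>
    rw [sum_fin_succ_fun]
    have h : ∀ x, ∑ ω : Fin N → Ω, (∏ i, p ((Fin.cons x ω : Fin (N + 1) → Ω) i)) *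
        (∑ i, Y ((Fin.cons x ω : Fin (N + 1) → Ω) i)) ^ 2 =
          p x * Y x ^ 2 + p x * (N * ∑ x, p x * Y x ^ 2) := by
      intro x
      simp only [Fin.prod_univ_succ, Fin.sum_univ_succ, Fin.cons_zero, Fin.cons_succ]
      calc _ = p x * Y x ^ 2 * ∑ ω : Fin N → Ω, ∏ i, p (ω i)
            + 2 * p x * Y x * ∑ ω : Fin N → Ω, (∏ i, p (ω i)) * ∑ i, Y (ω i)
            + p x * ∑ ω : Fin N → Ω, (∏ i, p (ω i)) * (∑ i, Y (ω i)) ^ 2 := by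
            rw [Finset.mul_sum, Finset.mul_sum, Finset.mul_sum, ← Finset.sum_add_distrib,
              ← Finset.sum_add_distrib]
            exact Finset.sum_congr rfl fun _ _ => by ring
        _ = _ := by rw [ih, sum_prod_eq_one h1, sum_prod_mul_sum h1 hm]; ring
    simp only [h, Finset.sum_add_distrib, ← Finset.sum_mul, h1]
    push_cast
    ring

/-- The mean absolute deviation of an empirical mean of `M ^ 2` samples of a `±1`-valued variable
with expectation `x` is at most `1 / M`. -/
theorem sum_prod_mul_abs_average_sub_le {p : Bool → ℝ} {x : ℝ} (hp : ∀ s, p s = (1 + outcome s * x) / 2)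
    (hp0 : ∀ s, 0 ≤ p s) {M : ℕ} (hM : 0 < M) :
    ∑ s : Fin (M ^ 2) → Bool, (∏ j, p (s j)) * |average s - x| ≤ 1 / M := by
  have hM' : (0 : ℝ) < M := by exact_mod_cast hM
  have h1 : ∑ s, p s = 1 := by simp [hp, outcome]; ring
  have hm : ∑ s, p s * (outcome s - x) = 0 := by simp [hp, outcome]; ring
  have hv : ∑ s, p s * (outcome s - x) ^ 2 ≤ 1 := by
    have : ∑ s, p s * (outcome s - x) ^ 2 = 1 - x ^ 2 := by simp [hp, outcome]; ring
    nlinarith [sq_nonneg x]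
  have havg : ∀ s : Fin (M ^ 2) → Bool,
      average s - x = (∑ j, (outcome (s j) - x)) / (M : ℝ) ^ 2 := by
    intro s
    rw [average, Finset.sum_sub_distrib, Finset.sum_const, Finset.card_univ, Fintype.card_fin,
      nsmul_eq_mul]
    push_cast
    field_simp
  -- AM-GM reduces the first absolute moment to the variance; since the variance is at most `1 / M ^
  -- 2`, this weighting makes both terms at most `1 / (2 * M)`.
  have habs : ∀ u : ℝ, |u| ≤ M / 2 * u ^ 2 + 1 / (2 * M) := by
    intro u
    have h : M / 2 * u ^ 2 + 1 / (2 * M) - |u| = (M * |u| - 1) ^ 2 / (2 * M) := by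
      rw [← sq_abs u]; field_simp; ring
    have : 0 ≤ (M * |u| - 1) ^ 2 / (2 * M) := by positivity
    linarith
  calc ∑ s : Fin (M ^ 2) → Bool, (∏ j, p (s j)) * |average s - x|
      ≤ ∑ s : Fin (M ^ 2) → Bool, (1 / (2 * (M : ℝ) ^ 3) *
          ((∏ j, p (s j)) * (∑ j, (outcome (s j) - x)) ^ 2) + 1 / (2 * M) * ∏ j, p (s j)) := by
        refine Finset.sum_le_sum fun s _ => ?_
        have h := mul_le_mul_of_nonneg_left (habs (average s - x))
          (Finset.prod_nonneg fun j _ => hp0 (s j) : 0 ≤ ∏ j, p (s j))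
        refine h.trans (le_of_eq ?_)
        rw [havg]
        field_simp
    _ = 1 / (2 * (M : ℝ) ^ 3) * ((M ^ 2 : ℕ) * ∑ s, p s * (outcome s - x) ^ 2) + 1 / (2 * M) := by
        rw [Finset.sum_add_distrib, ← Finset.mul_sum, ← Finset.mul_sum,
          sum_prod_mul_sum_sq (Y := fun s => outcome s - x) h1 hm, sum_prod_eq_one h1, mul_one]
    _ ≤ 1 / (2 * (M : ℝ) ^ 3) * ((M ^ 2 : ℕ) * 1) + 1 / (2 * M) := by gcongr
    _ = 1 / M := by push_cast; field_simp; norm_num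

end FiniteProbability

/-! ### The function `2ab / (a² + b²)` -/

theorem abs_two_mul_div_le_one (a b : ℝ) : |2 * a * b / (a ^ 2 + b ^ 2)| ≤ 1 := by
  rw [abs_div, abs_of_nonneg (by positivity : 0 ≤ a ^ 2 + b ^ 2)]
  refine div_le_one_of_le₀ (abs_le.mpr ⟨?_, ?_⟩) (by positivity)
  · nlinarith [sq_nonneg (a + b)]
  · nlinarith [sq_nonneg (a - b)]

/-- `2ab / (a² + b²)` is Lipschitz away from the origin. -/
theorem abs_two_mul_div_sub_le {a b x y r : ℝ} (hr : 0 < r) (hxy : r ^ 2 ≤ x ^ 2 + y ^ 2) :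
    |2 * a * b / (a ^ 2 + b ^ 2) - 2 * x * y / (x ^ 2 + y ^ 2)| ≤
      2 / r * (|a - x| + |b - y|) := by
  have hR : 0 < x ^ 2 + y ^ 2 := lt_of_lt_of_le (by positivity) hxy
  rcases (by positivity : 0 ≤ a ^ 2 + b ^ 2).eq_or_lt with h0 | hS
  -- At the origin the quotient has the default value 0. The left side is then at most 1, and the
  -- right side is at least 2 because `|x| + |y| ≥ r`.
  · have ha : a = 0 := by nlinarith [sq_nonneg a, sq_nonneg b]
    have hb : b = 0 := by nlinarith [sq_nonneg a, sq_nonneg b]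
    subst ha hb
    have hle : r ≤ |x| + |y| := by
      refine le_of_sq_le_sq ?_ (by positivity)
      nlinarith [sq_abs x, sq_abs y, mul_nonneg (abs_nonneg x) (abs_nonneg y)]
    have := abs_two_mul_div_le_one x y
    simp only [mul_zero, zero_div, zero_sub, abs_neg]
    rw [div_mul_eq_mul_div]
    refine this.trans ((one_le_div hr).mpr ?_)
    linarith
  · set s := Real.sqrt (a ^ 2 + b ^ 2) with hs
    set q := Real.sqrt (x ^ 2 + y ^ 2) with hq
    have hs2 : s ^ 2 = a ^ 2 + b ^ 2 := Real.sq_sqrt hS.le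
    have hq2 : q ^ 2 = x ^ 2 + y ^ 2 := Real.sq_sqrt hR.le
    have hs0 : 0 < s := Real.sqrt_pos.mpr hS
    have hq0 : 0 < q := Real.sqrt_pos.mpr hR
    have hrq : r ≤ q := Real.le_sqrt_of_sq_le hxy
    -- In polar coordinates the quotient is the sine of the doubled angle; the two factors come from
    -- `sin 2α - sin 2β = 2 cos (α + β) sin (α - β)`. The cosine is bounded trivially, the sine by
    -- the displacement.
    have h1 : |a * x - b * y| ≤ s * q := by
      refine abs_le_of_sq_le_sq ?_ (by positivity)
      rw [mul_pow, hs2, hq2]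
      nlinarith [sq_nonneg (a * y + b * x)]
    have h2 : |b * x - y * a| ≤ s * (|a - x| + |b - y|) := by
      have ea : |a| ≤ s := Real.abs_le_sqrt (by nlinarith [sq_nonneg b])
      have eb : |b| ≤ s := Real.abs_le_sqrt (by nlinarith [sq_nonneg a])
      calc |b * x - y * a| = |a * (b - y) - b * (a - x)| := by ring_nf
        _ ≤ |a| * |b - y| + |b| * |a - x| := by
            rw [← abs_mul, ← abs_mul]; exact abs_sub _ _
        _ ≤ s * |b - y| + s * |a - x| := by gcongr
        _ = _ := by ring
    have heq : 2 * a * b / (a ^ 2 + b ^ 2) - 2 * x * y / (x ^ 2 + y ^ 2) =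
        2 * ((a * x - b * y) * (b * x - y * a)) / (s ^ 2 * q ^ 2) := by
      rw [hs2, hq2]
      field_simp
      ring
    rw [heq, abs_div, abs_mul, abs_mul, abs_two, abs_of_pos (by positivity : 0 < s ^ 2 * q ^ 2)]
    calc 2 * (|a * x - b * y| * |b * x - y * a|) / (s ^ 2 * q ^ 2)
        ≤ 2 * ((s * q) * (s * (|a - x| + |b - y|))) / (s ^ 2 * q ^ 2) := by gcongr
      _ = 2 / q * (|a - x| + |b - y|) := by field_simp
      _ ≤ _ := by gcongr

/-! ### Pauli strings and Clifford conjugation -/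

variable {n : ℕ}

theorem pauliOne_completeness (i j k l : Fin 2) :
    ∑ c, pauliOne c i j * pauliOne c k l = if i = l ∧ j = k then 2 else 0 := by
  fin_cases i <;> fin_cases j <;> fin_cases k <;> fin_cases l <;>
    simp [pauliOne, Fin.sum_univ_four] <;> norm_num

theorem star_pauliOne (c : Fin 4) (i j : Fin 2) : star (pauliOne c i j) = pauliOne c j i := by
  fin_cases c <;> fin_cases i <;> fin_cases j <;> simp [pauliOne]

theorem pauliOne_orthogonality (c d : Fin 4) :
    ∑ i, ∑ j, pauliOne c i j * pauliOne d j i = if c = d then 2 else 0 := by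
  fin_cases c <;> fin_cases d <;> simp [pauliOne] <;> norm_num

theorem pauliOne_mul_self (c : Fin 4) (i k : Fin 2) :
    ∑ j, pauliOne c i j * pauliOne c j k = if i = k then 1 else 0 := by
  fin_cases c <;> fin_cases i <;> fin_cases k <;> simp [pauliOne]

theorem pauliOne_mem_gaussianInt (c : Fin 4) (i j : Fin 2) :
    pauliOne c i j ∈ GaussianInt.toComplex.range := by
  have hI : Complex.I ∈ GaussianInt.toComplex.range := ⟨⟨0, 1⟩, by simp [GaussianInt.toComplex_def]⟩
  fin_cases c <;> fin_cases i <;> fin_cases j <;>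
    simp only [pauliOne, Fin.zero_eta, Fin.mk_one, Fin.reduceFinMk, Matrix.of_apply,
      Matrix.cons_val] <;>
    first
      | exact zero_mem _ | exact one_mem _ | exact neg_mem (one_mem _) | exact hI
      | exact neg_mem hI

theorem sum_prod_pi {ι κ : Type*} [Fintype ι] [DecidableEq ι] [Fintype κ] (f : ι → κ → ℂ) :
    ∑ a : ι → κ, ∏ i, f i (a i) = ∏ i, ∑ c, f i c := by
  simpa using (Finset.prod_univ_sum (fun _ : ι => (Finset.univ : Finset κ)) f).symm

/-- The identity `∑ P_a ⊗ P_a = 2 ^ n • SWAP` in matrix entries; it factorises over the qubits. -/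
theorem pauli_completeness (i j k l : Bits n) :
    ∑ a : PauliLabel n, pauli a i j * pauli a k l = if i = l ∧ j = k then 2 ^ n else 0 := by
  simp only [pauli, Matrix.of_apply, ← Finset.prod_mul_distrib]
  rw [sum_prod_pi (fun m c => pauliOne c (i m) (j m) * pauliOne c (k m) (l m))]
  simp only [pauliOne_completeness]
  split_ifs with h
  · obtain ⟨rfl, rfl⟩ := h
    simp
  · have : ∃ m, ¬ (i m = l m ∧ j m = k m) := by
      by_contra! hc
      exact h ⟨funext fun m => (hc m).1, funext fun m => (hc m).2⟩
    obtain ⟨m, hm⟩ := this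
    exact Finset.prod_eq_zero (Finset.mem_univ m) (if_neg hm)

theorem pauli_conjTranspose (a : PauliLabel n) : (pauli a).conjTranspose = pauli a := by
  ext i j
  simp only [Matrix.conjTranspose_apply, pauli, Matrix.of_apply, star_prod, star_pauliOne]

theorem pauli_mul_self (a : PauliLabel n) : pauli a * pauli a = 1 := by
  ext i k
  simp only [Matrix.mul_apply, pauli, Matrix.of_apply, ← Finset.prod_mul_distrib]
  rw [sum_prod_pi (fun m c => pauliOne (a m) (i m) c * pauliOne (a m) c (k m))]
  simp only [pauliOne_mul_self, Matrix.one_apply]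
  split_ifs with h
  · subst h; simp
  · obtain ⟨m, hm⟩ := Function.ne_iff.mp h
    exact Finset.prod_eq_zero (Finset.mem_univ m) (if_neg hm)

theorem trace_pauli_mul_pauli {a b : PauliLabel n} (h : a ≠ b) :
    Matrix.trace (pauli a * pauli b) = 0 := by
  have h1 : Matrix.trace (pauli a * pauli b) =
      ∏ m, ∑ i, ∑ j, pauliOne (a m) i j * pauliOne (b m) j i := by
    simp only [Matrix.trace, Matrix.diag_apply, Matrix.mul_apply, pauli, Matrix.of_apply,
      ← Finset.prod_mul_distrib]
    rw [← sum_prod_pi (fun m i => ∑ j, pauliOne (a m) i j * pauliOne (b m) j i)]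
    refine Finset.sum_congr rfl fun z _ => ?_
    rw [← sum_prod_pi (fun m j => pauliOne (a m) (z m) j * pauliOne (b m) j (z m))]
  obtain ⟨m, hm⟩ := Function.ne_iff.mp h
  rw [h1]
  exact Finset.prod_eq_zero (Finset.mem_univ m) ((pauliOne_orthogonality _ _).trans (if_neg hm))

theorem pauli_mem_gaussianInt (a : PauliLabel n) (i j : Bits n) :
    pauli a i j ∈ GaussianInt.toComplex.range := by
  rw [pauli, Matrix.of_apply]
  exact prod_mem fun m _ => pauliOne_mem_gaussianInt (a m) (i m) (j m)

/-- Parseval's identity for the Pauli basis, obtained by contracting `pauli_completeness` with both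
operators. -/
theorem sum_trace_mul_pauli (ρ σ : Op n) :
    ∑ a : PauliLabel n, Matrix.trace (ρ * pauli a) * Matrix.trace (σ * pauli a) =
      2 ^ n * Matrix.trace (ρ * σ) := by
  have h : ∀ a : PauliLabel n, Matrix.trace (ρ * pauli a) * Matrix.trace (σ * pauli a) =
      ∑ i, ∑ j, ∑ k, ∑ l, ρ i j * σ k l * (pauli a j i * pauli a l k) := by
    intro a
    simp only [Matrix.trace, Matrix.diag_apply, Matrix.mul_apply, Finset.sum_mul]
    refine Finset.sum_congr rfl fun i _ => Finset.sum_congr rfl fun j _ => ?_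
    rw [Finset.mul_sum]
    refine Finset.sum_congr rfl fun k _ => ?_
    rw [Finset.mul_sum]
    exact Finset.sum_congr rfl fun l _ => by ring
  simp only [h]
  rw [Finset.sum_comm]
  simp only [Matrix.trace, Matrix.diag_apply, Matrix.mul_apply, Finset.mul_sum]
  refine Finset.sum_congr rfl fun i _ => ?_
  rw [Finset.sum_comm]
  refine Finset.sum_congr rfl fun j _ => ?_
  rw [Finset.sum_comm]
  have h2 : ∀ k, ∑ a : PauliLabel n, ∑ l, ρ i j * σ k l * (pauli a j i * pauli a l k) =
      if k = j then 2 ^ n * (ρ i j * σ j i) else 0 := by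
    intro k
    rw [Finset.sum_comm]
    simp only [← Finset.mul_sum, pauli_completeness]
    by_cases hk : k = j
    · subst hk
      simp [mul_comm]
    · simp [hk, Ne.symm hk]
  simp [h2]

/-- A real Clifford unitary maps the Pauli strings onto the Pauli strings, up to phases. -/
theorem exists_conj_pauli {C : Op n} (hC : C ∈ realClifford n) (b : PauliLabel n) :
    ∃ (k : ℕ) (a : PauliLabel n), C.conjTranspose * pauli b * C = Complex.I ^ k • pauli a := by
  obtain ⟨hU, -, hP⟩ := hC
  have hCC : C.conjTranspose * C = 1 := Matrix.mem_unitaryGroup_iff'.mp hU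
  choose k f hf using hP
  have hconj : ∀ a, Complex.I ^ k a • (C.conjTranspose * pauli (f a) * C) = pauli a := by
    intro a
    calc Complex.I ^ k a • (C.conjTranspose * pauli (f a) * C)
        = C.conjTranspose * (C * pauli a * C.conjTranspose) * C := by
          rw [hf]; simp
      _ = (C.conjTranspose * C) * pauli a * (C.conjTranspose * C) := by
          simp only [Matrix.mul_assoc]
      _ = pauli a := by rw [hCC]; simp
  -- Labels with the same image would have proportional Pauli strings, against trace orthogonality.
  -- Finiteness then makes `f` surjective, so every `b` has a preimage.
  have hinj : Function.Injective f := by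
    intro a a' h
    by_contra hne
    have h1 : Complex.I ^ k a' • pauli a = Complex.I ^ k a • pauli a' := by
      rw [← hconj a, ← hconj a', h, smul_comm]
    have h2 := congrArg (fun A => Matrix.trace (A * pauli a')) h1
    simp [trace_pauli_mul_pauli hne, pauli_mul_self, Matrix.trace_one] at h2
  obtain ⟨a, rfl⟩ := Finite.surjective_of_injective hinj b
  -- `I ^ (3 * k)` is the inverse of `I ^ k`.
  refine ⟨3 * k a, a, ?_⟩
  have h4 : Complex.I ^ (3 * k a) * Complex.I ^ k a = 1 := by
    rw [← pow_add, show 3 * k a + k a = 4 * k a by ring, pow_mul, Complex.I_pow_four, one_pow]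
  rw [← hconj a, smul_smul, h4, one_smul]

/-! ### The W state, its Clifford orbit and the gap in Pauli expectation values -/

theorem star_wState (n : ℕ) : star (wState n) = wState n := by
  ext z
  simp only [Pi.star_apply, wState]
  split_ifs <;> simp

theorem card_weight_one (n : ℕ) :
    (Finset.univ.filter fun z : Bits n => ∑ i, (z i : ℕ) = 1).card = n := by
  have h : (Finset.univ.filter fun z : Bits n => ∑ i, (z i : ℕ) = 1) =
      Finset.univ.image fun i : Fin n => (Pi.single i 1 : Bits n) := by
    ext z
    simp only [Finset.mem_filter, Finset.mem_univ, true_and, Finset.mem_image]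
    constructor
    · intro hz
      have hex : ∃ i, z i ≠ 0 := by
        by_contra! hc
        simp [hc] at hz
      obtain ⟨i, hi⟩ := hex
      have hi1 : z i = 1 := by omega
      refine ⟨i, funext fun j => ?_⟩
      by_cases hj : j = i
      · subst hj; simp [hi1]
      · rw [Pi.single_eq_of_ne hj]
        have := Finset.add_le_sum (f := fun i => (z i : ℕ)) (fun _ _ => Nat.zero_le _)
          (Finset.mem_univ i) (Finset.mem_univ j) (Ne.symm hj)
        simp only [hz, hi1] at this
        have h1 : ((1 : Fin 2) : ℕ) = 1 := rfl
        omega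
    · rintro ⟨i, rfl⟩
      rw [Finset.sum_eq_single i]
      · simp
      · intro j _ hj
        simp [Pi.single_eq_of_ne hj]
      · simp
  rw [h, Finset.card_image_of_injective, Finset.card_univ, Fintype.card_fin]
  intro i j hij
  by_contra hne
  have := congrFun hij i
  simp [Pi.single_eq_of_ne hne] at this

theorem wState_normalized (hn : 0 < n) : wState n ⬝ᵥ wState n = 1 := by
  have hn' : (n : ℂ) ≠ 0 := by exact_mod_cast hn.ne'
  have h : ∀ z, wState n z * wState n z =
      if ∑ i, (z i : ℕ) = 1 then (n : ℂ)⁻¹ else 0 := by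
    intro z
    simp only [wState]
    split_ifs
    · rw [← Complex.ofReal_mul, div_mul_div_comm, Real.mul_self_sqrt (Nat.cast_nonneg n)]
      simp
    · simp
  simp only [dotProduct, h]
  rw [← Finset.sum_filter, Finset.sum_const, card_weight_one, nsmul_eq_mul, mul_inv_cancel₀ hn']

/-- Products of two amplitudes are 0 or `1 / n`, and Pauli entries are Gaussian integers, so the
factor `n` clears all denominators. -/
theorem wState_pauli_mem_gaussianInt (a : PauliLabel n) :
    (n : ℂ) * (wState n ⬝ᵥ (pauli a).mulVec (wState n)) ∈ GaussianInt.toComplex.range := by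
  rcases Nat.eq_zero_or_pos n with rfl | hn
  · simp
  have hn' : (n : ℂ) ≠ 0 := by exact_mod_cast hn.ne'
  have h : ∀ x y : Bits n, (n : ℂ) * (wState n x * wState n y) ∈ GaussianInt.toComplex.range := by
    intro x y
    simp only [wState]
    split_ifs
    · rw [← Complex.ofReal_mul, div_mul_div_comm, Real.mul_self_sqrt (Nat.cast_nonneg n)]
      simp [hn']
    all_goals simp
  simp only [dotProduct, Matrix.mulVec, Finset.mul_sum]
  refine sum_mem fun x _ => sum_mem fun y _ => ?_
  rw [show (n : ℂ) * (wState n x * (pauli a x y * wState n y)) =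
    (n : ℂ) * (wState n x * wState n y) * pauli a x y by ring]
  exact mul_mem (h x y) (pauli_mem_gaussianInt a x y)

theorem trace_pureState_mul (ψ : Bits n → ℂ) (A : Op n) :
    Matrix.trace (pureState ψ * A) = star ψ ⬝ᵥ A.mulVec ψ := by
  rw [pureState, Matrix.vecMulVec_mul, Matrix.trace_vecMulVec, Matrix.dotProduct_mulVec,
    dotProduct_comm]

/-- This is where the Clifford unitary must be real; `bellDist_pureState` depends on it. -/
theorem star_CW {ψ : Bits n → ℂ} (hψ : ψ ∈ CW n) : star ψ = ψ := by
  obtain ⟨C, hC, rfl⟩ := hψ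
  have hs : ∀ x y, star (C x y) = C x y := fun x y => Complex.conj_eq_iff_im.mpr (hC.2.1 x y)
  ext z
  simp only [Pi.star_apply, Matrix.mulVec, dotProduct, star_sum, star_mul', hs]
  exact Finset.sum_congr rfl fun y _ => by rw [← Pi.star_apply, star_wState]

theorem CW_expectation {C : Op n} (A : Op n) :
    star (C.mulVec (wState n)) ⬝ᵥ A.mulVec (C.mulVec (wState n)) =
      wState n ⬝ᵥ (C.conjTranspose * A * C).mulVec (wState n) := by
  rw [Matrix.star_mulVec, star_wState, Matrix.mulVec_mulVec, ← Matrix.dotProduct_mulVec,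
    Matrix.mulVec_mulVec, Matrix.mul_assoc]

theorem CW_normalized (hn : 0 < n) {ψ : Bits n → ℂ} (hψ : ψ ∈ CW n) : star ψ ⬝ᵥ ψ = 1 := by
  obtain ⟨C, hC, rfl⟩ := hψ
  have hCC : C.conjTranspose * C = 1 := Matrix.mem_unitaryGroup_iff'.mp hC.1
  have h := CW_expectation (C := C) 1
  rwa [Matrix.one_mulVec, Matrix.mul_one, hCC, Matrix.one_mulVec,
    wState_normalized hn] at h

/-- The expectation value `tr(ρ P_a)`. -/
noncomputable def pauliExpect (ρ : Op n) (a : PauliLabel n) : ℝ := (Matrix.trace (ρ * pauli a)).re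

/-- Moving the Clifford onto the observable turns `P_a` into a Pauli string times a power of `i`,
which is again a Gaussian integer, so the claim reduces to the W state. -/
theorem exists_int_pauliExpect {ψ : Bits n → ℂ} (hψ : ψ ∈ CW n) (a : PauliLabel n) :
    ∃ m : ℤ, (n : ℝ) * pauliExpect (pureState ψ) a = m := by
  obtain ⟨C, hC, rfl⟩ := hψ
  obtain ⟨k, b, hb⟩ := exists_conj_pauli hC a
  have hI : Complex.I ∈ GaussianInt.toComplex.range := ⟨⟨0, 1⟩, by simp [GaussianInt.toComplex_def]⟩
  have h : (n : ℂ) * Matrix.trace (pureState (C.mulVec (wState n)) * pauli a) ∈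
      GaussianInt.toComplex.range := by
    rw [trace_pureState_mul, CW_expectation, hb, Matrix.smul_mulVec, dotProduct_smul, smul_eq_mul,
      mul_left_comm]
    exact mul_mem (pow_mem hI k) (wState_pauli_mem_gaussianInt b)
  obtain ⟨m, hm⟩ := h
  refine ⟨m.re, ?_⟩
  have := congrArg Complex.re hm
  simpa [pauliExpect] using this.symm

theorem one_div_le_abs_pauliExpect {ψ : Bits n → ℂ} (hψ : ψ ∈ CW n) {a : PauliLabel n}
    (h0 : pauliExpect (pureState ψ) a ≠ 0) : 1 / (n : ℝ) ≤ |pauliExpect (pureState ψ) a| := by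
  obtain ⟨m, hm⟩ := exists_int_pauliExpect hψ a
  rcases Nat.eq_zero_or_pos n with rfl | hn
  · simp
  have hn' : (0 : ℝ) < n := by exact_mod_cast hn
  have hm0 : m ≠ 0 := by
    rintro rfl
    simp [hn'.ne', h0] at hm
  have h1 : (1 : ℝ) ≤ |(m : ℝ)| := by exact_mod_cast Int.one_le_abs hm0
  rw [← hm, abs_mul, abs_of_pos hn'] at h1
  rw [div_le_iff₀ hn']
  linarith

/-! ### Measurement probabilities of pure states -/

theorem trace_pureState_mul_pauli (ψ : Bits n → ℂ) (a : PauliLabel n) :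
    Matrix.trace (pureState ψ * pauli a) = (pauliExpect (pureState ψ) a : ℂ) := by
  refine (Complex.conj_eq_iff_re.mp ?_).symm
  have h : (pureState ψ).conjTranspose = pureState ψ := by
    simp [pureState, Matrix.conjTranspose_vecMulVec]
  change star _ = _
  rw [← Matrix.trace_conjTranspose, Matrix.conjTranspose_mul, pauli_conjTranspose, h,
    Matrix.trace_mul_comm]

theorem pauliProb_pureState {ψ : Bits n → ℂ} (hψ : star ψ ⬝ᵥ ψ = 1) (a : PauliLabel n) (s : Bool) :
    pauliProb (pureState ψ) a s = (1 + outcome s * pauliExpect (pureState ψ) a) / 2 := by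
  rw [pauliProb, mul_smul_comm, mul_add, mul_smul_comm, Matrix.trace_smul, Matrix.trace_add,
    Matrix.trace_smul, trace_pureState_mul_pauli, trace_pureState_mul, Matrix.one_mulVec, hψ,
    smul_eq_mul, smul_eq_mul]
  rw [show (1 / 2 : ℂ) * (1 + (outcome s : ℂ) * (pauliExpect (pureState ψ) a : ℂ)) =
    (((1 + outcome s * pauliExpect (pureState ψ) a) / 2 : ℝ) : ℂ) by push_cast; ring]
  exact Complex.ofReal_re _

open scoped ComplexOrder in
-- The effect `Q = (1 ± P_a) / 2` is a projector, so the probability is the squared norm of `Q ψ`.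
theorem pauliProb_nonneg (ψ : Bits n → ℂ) (a : PauliLabel n) (s : Bool) :
    0 ≤ pauliProb (pureState ψ) a s := by
  set Q : Op n := (1 / 2 : ℂ) • (1 + (outcome s : ℂ) • pauli a) with hQ
  have hs : (outcome s : ℂ) = 1 ∨ (outcome s : ℂ) = -1 := by cases s <;> simp [outcome]
  have hH : Q.conjTranspose = Q := by
    simp [hQ, Matrix.conjTranspose_smul, pauli_conjTranspose]
  have hQQ : Q.conjTranspose * Q = Q := by
    rw [hH, hQ]
    rcases hs with hs | hs <;> rw [hs] <;>
      simp only [mul_add, add_mul, mul_one, one_mul, pauli_mul_self, smul_mul_assoc,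
        mul_smul_comm] <;> module
  rw [pauliProb, ← hQ, trace_pureState_mul, ← hQQ, ← Matrix.mulVec_mulVec,
    Matrix.dotProduct_mulVec, ← Matrix.star_mulVec]
  exact (Complex.nonneg_iff.mp (dotProduct_star_self_nonneg _)).1

theorem bellVec_apply (a : PauliLabel n) (z w : Bits n) :
    bellVec a (z, w) = ((1 / Real.sqrt (2 ^ n) : ℝ) : ℂ) * pauli a w z := by
  simp only [bellVec, Matrix.mulVec, dotProduct, bellZero, Fintype.sum_prod_type,
    Matrix.kroneckerMap_apply, Matrix.one_apply]
  simp [mul_comm]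

/-- The overlap of `Φ_a` with `ψ ⊗ ψ` pairs `P_a ψ` with the conjugate of `ψ`; for real `ψ` this is
the expectation value, up to `2 ^ (-n / 2)`. -/
theorem bellDist_pureState {ψ : Bits n → ℂ} (hψ : star ψ = ψ) (a : PauliLabel n) :
    bellDist (pureState ψ) a = pauliExpect (pureState ψ) a ^ 2 / 2 ^ n := by
  set φ : Bits n × Bits n → ℂ := fun p => ψ p.1 * ψ p.2 with hφ
  have hk : pureState ψ ⊗ₖ pureState ψ = Matrix.vecMulVec φ (star φ) := by
    ext p q
    simp only [Matrix.kroneckerMap_apply, pureState, Matrix.vecMulVec_apply, hφ, Pi.star_apply,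
      star_mul']
    ring
  have hov : star (bellVec a) ⬝ᵥ φ =
      ((1 / Real.sqrt (2 ^ n) * pauliExpect (pureState ψ) a : ℝ) : ℂ) := by
    rw [Complex.ofReal_mul, ← trace_pureState_mul_pauli, trace_pureState_mul, hψ]
    simp only [dotProduct, Fintype.sum_prod_type, Matrix.mulVec, Finset.mul_sum]
    refine Finset.sum_congr rfl fun z _ => Finset.sum_congr rfl fun w _ => ?_
    have hp : star (pauli a w z) = pauli a z w := by
      rw [← Matrix.conjTranspose_apply, pauli_conjTranspose]
    rw [Pi.star_apply, bellVec_apply, star_mul', hp, hφ, Complex.star_def, Complex.conj_ofReal]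
    ring
  have hov' : star φ ⬝ᵥ bellVec a =
      ((1 / Real.sqrt (2 ^ n) * pauliExpect (pureState ψ) a : ℝ) : ℂ) := by
    rw [Matrix.star_dotProduct, hov, Complex.star_def, Complex.conj_ofReal]
  rw [bellDist, hk, Matrix.vecMulVec_mulVec, dotProduct_smul, hov, hov', MulOpposite.smul_eq_mul_unop,
    MulOpposite.unop_op, ← Complex.ofReal_mul, Complex.ofReal_re, mul_mul_mul_comm, div_mul_div_comm,
    Real.mul_self_sqrt (by positivity)]
  ring

theorem sum_pauliExpect_mul (ψ φ : Bits n → ℂ) :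
    ∑ a, pauliExpect (pureState ψ) a * pauliExpect (pureState φ) a / 2 ^ n =
      (Matrix.trace (pureState ψ * pureState φ)).re := by
  have h := sum_trace_mul_pauli (pureState ψ) (pureState φ)
  simp only [trace_pureState_mul_pauli] at h
  have h2 := congrArg Complex.re h
  rw [show (2 : ℂ) ^ n = ((2 ^ n : ℝ) : ℂ) by push_cast; rfl, Complex.re_ofReal_mul] at h2
  rw [← Finset.sum_div, div_eq_iff (by positivity), mul_comm _ ((2 : ℝ) ^ n), ← h2]
  simp

theorem purity_pureState {ψ : Bits n → ℂ} (hψ : star ψ ⬝ᵥ ψ = 1) : purity (pureState ψ) = 1 := by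
  rw [purity, trace_pureState_mul, pureState, Matrix.vecMulVec_mulVec, dotProduct_smul, hψ]
  simp

/-! ### One round of rDIPE: normalisation and bias -/

/-- Conditioning on the label, so that the bias can be estimated label by label. -/
theorem sum_roundProb_mul (ρ σ : Op n) {N₂ : ℕ} (F : Round n N₂ → ℝ) :
    ∑ r, roundProb ρ σ r * F r =
      ∑ a, (bellDist ρ a + bellDist σ a) / 2 *
        ∑ s, ∑ t, (∏ j, pauliProb ρ a (s j)) * (∏ j, pauliProb σ a (t j)) * F (a, s, t) := by
  rw [Fintype.sum_prod_type]
  simp only [Fintype.sum_prod_type, roundProb, Finset.mul_sum, mul_assoc]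

theorem sum_prod_pauliProb {ψ : Bits n → ℂ} (hψ : star ψ ⬝ᵥ ψ = 1) (a : PauliLabel n) (N : ℕ) :
    ∑ s : Fin N → Bool, ∏ j, pauliProb (pureState ψ) a (s j) = 1 := by
  refine sum_prod_eq_one ?_ N
  simp [pauliProb_pureState hψ, outcome]
  ring

theorem prod_pauliProb_nonneg (ψ : Bits n → ℂ) (a : PauliLabel n) {N : ℕ} (s : Fin N → Bool) :
    0 ≤ ∏ j, pauliProb (pureState ψ) a (s j) :=
  Finset.prod_nonneg fun j _ => pauliProb_nonneg ψ a (s j)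

/-- The label distribution of a round is normalized. -/
theorem sum_bellDist {ψ φ : Bits n → ℂ} (hψ : star ψ = ψ) (hφ : star φ = φ)
    (hψ1 : star ψ ⬝ᵥ ψ = 1) (hφ1 : star φ ⬝ᵥ φ = 1) :
    ∑ a, (bellDist (pureState ψ) a + bellDist (pureState φ) a) / 2 = 1 := by
  have h : ∀ {χ : Bits n → ℂ}, star χ = χ → star χ ⬝ᵥ χ = 1 →
      ∑ a, bellDist (pureState χ) a = 1 := by
    intro χ h h1
    rw [← purity_pureState h1, purity, ← sum_pauliExpect_mul]
    exact Finset.sum_congr rfl fun a _ => by rw [bellDist_pureState h, sq]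
  rw [← Finset.sum_div, Finset.sum_add_distrib, h hψ hψ1, h hφ hφ1]
  norm_num

theorem bellDist_add_nonneg {ψ φ : Bits n → ℂ} (hψ : star ψ = ψ) (hφ : star φ = φ)
    (a : PauliLabel n) : 0 ≤ (bellDist (pureState ψ) a + bellDist (pureState φ) a) / 2 := by
  rw [bellDist_pureState hψ, bellDist_pureState hφ]
  positivity

theorem roundProb_nonneg {ψ φ : Bits n → ℂ} (hψ : star ψ = ψ) (hφ : star φ = φ) {N : ℕ}
    (r : Round n N) : 0 ≤ roundProb (pureState ψ) (pureState φ) r :=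
  mul_nonneg (bellDist_add_nonneg hψ hφ _)
    (mul_nonneg (prod_pauliProb_nonneg _ _ _) (prod_pauliProb_nonneg _ _ _))

theorem sum_roundProb {ψ φ : Bits n → ℂ} (hψ : star ψ = ψ) (hφ : star φ = φ)
    (hψ1 : star ψ ⬝ᵥ ψ = 1) (hφ1 : star φ ⬝ᵥ φ = 1) (N : ℕ) :
    ∑ r : Round n N, roundProb (pureState ψ) (pureState φ) r = 1 := by
  have h := sum_roundProb_mul (pureState ψ) (pureState φ) (fun _ : Round n N => 1)
  simpa [← Finset.mul_sum, sum_prod_pauliProb hψ1, sum_prod_pauliProb hφ1,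
    sum_bellDist hψ hφ hψ1 hφ1] using h

/-- The contribution of one round to the estimator, for states of equal purity. -/
noncomputable def roundValue {N₂ : ℕ} (r : Round n N₂) : ℝ :=
  2 * average r.2.1 * average r.2.2 / (average r.2.1 ^ 2 + average r.2.2 ^ 2)

theorem estimator_pureState {ψ φ : Bits n → ℂ} (hψ1 : star ψ ⬝ᵥ ψ = 1) (hφ1 : star φ ⬝ᵥ φ = 1)
    {N₁ N₂ : ℕ} (ω : Run n N₁ N₂) :
    estimator (pureState ψ) (pureState φ) ω = 1 / (N₁ : ℝ) * ∑ i, roundValue (ω i) := by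
  simp [estimator, purity_pureState hψ1, purity_pureState hφ1, roundValue]

/-- With exact Pauli expectation values the estimator is unbiased. -/
theorem sum_bellDist_mul {ψ φ : Bits n → ℂ} (hψ : star ψ = ψ) (hφ : star φ = φ)
    (hψ1 : star ψ ⬝ᵥ ψ = 1) (hφ1 : star φ ⬝ᵥ φ = 1) :
    ∑ a, (bellDist (pureState ψ) a + bellDist (pureState φ) a) / 2 *
        (2 * pauliExpect (pureState ψ) a * pauliExpect (pureState φ) a /
          (pauliExpect (pureState ψ) a ^ 2 + pauliExpect (pureState φ) a ^ 2)) =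
      cosine (pureState ψ) (pureState φ) := by
  rw [cosine, purity_pureState hψ1, purity_pureState hφ1, mul_one, Real.sqrt_one, div_one,
    ← sum_pauliExpect_mul]
  refine Finset.sum_congr rfl fun a _ => ?_
  rw [bellDist_pureState hψ, bellDist_pureState hφ]
  set x := pauliExpect (pureState ψ) a
  set y := pauliExpect (pureState φ) a
  -- If both expectation values vanish, the quotient is 0 by default and so is `x * y`; otherwise
  -- the weight cancels the denominator.
  by_cases h : x ^ 2 + y ^ 2 = 0
  · have hx : x = 0 := by nlinarith [sq_nonneg x, sq_nonneg y]
    simp [hx]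
  · field_simp

/-- The conditional bias of a round whose label carries a Pauli expectation value at least `r`. -/
theorem abs_sum_roundValue_sub_le {ψ φ : Bits n → ℂ} (hψ1 : star ψ ⬝ᵥ ψ = 1)
    (hφ1 : star φ ⬝ᵥ φ = 1) (a : PauliLabel n) {r : ℝ} (hr : 0 < r)
    (ha : r ^ 2 ≤ pauliExpect (pureState ψ) a ^ 2 + pauliExpect (pureState φ) a ^ 2)
    {M : ℕ} (hM : 0 < M) :
    |(∑ s : Fin (M ^ 2) → Bool, ∑ t : Fin (M ^ 2) → Bool,
        (∏ j, pauliProb (pureState ψ) a (s j)) * (∏ j, pauliProb (pureState φ) a (t j)) *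
          roundValue (a, s, t)) -
      2 * pauliExpect (pureState ψ) a * pauliExpect (pureState φ) a /
          (pauliExpect (pureState ψ) a ^ 2 + pauliExpect (pureState φ) a ^ 2)| ≤
      4 / (r * M) := by
  set x := pauliExpect (pureState ψ) a
  set y := pauliExpect (pureState φ) a
  set p : (Fin (M ^ 2) → Bool) → ℝ := fun s => ∏ j, pauliProb (pureState ψ) a (s j)
  set q : (Fin (M ^ 2) → Bool) → ℝ := fun t => ∏ j, pauliProb (pureState φ) a (t j)
  have hp0 : ∀ s, 0 ≤ p s := fun s => prod_pauliProb_nonneg ψ a s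
  have hq0 : ∀ t, 0 ≤ q t := fun t => prod_pauliProb_nonneg φ a t
  have hp1 : ∑ s, p s = 1 := sum_prod_pauliProb hψ1 a _
  have hq1 : ∑ t, q t = 1 := sum_prod_pauliProb hφ1 a _
  have hpM : ∑ s, p s * |average s - x| ≤ 1 / M :=
    sum_prod_mul_abs_average_sub_le (pauliProb_pureState hψ1 a) (pauliProb_nonneg ψ a) hM
  have hqM : ∑ t, q t * |average t - y| ≤ 1 / M :=
    sum_prod_mul_abs_average_sub_le (pauliProb_pureState hφ1 a) (pauliProb_nonneg φ a) hM
  set g := 2 * x * y / (x ^ 2 + y ^ 2) with hg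
  have hsub : (∑ s, ∑ t, p s * q t * roundValue (a, s, t)) - g =
      ∑ s, ∑ t, p s * q t * (roundValue (a, s, t) - g) := by
    simp only [mul_sub, Finset.sum_sub_distrib]
    congr 1
    simp only [← Finset.sum_mul, ← Finset.mul_sum, hq1, mul_one, hp1, one_mul]
  calc |(∑ s, ∑ t, p s * q t * roundValue (a, s, t)) - g|
      ≤ ∑ s, ∑ t, |p s * q t * (roundValue (a, s, t) - g)| := by
        rw [hsub]
        exact (Finset.abs_sum_le_sum_abs _ _).trans
          (Finset.sum_le_sum fun s _ => Finset.abs_sum_le_sum_abs _ _)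
    _ ≤ ∑ s, ∑ t, 2 / r * (p s * |average s - x| * q t + p s * (q t * |average t - y|)) := by
        refine Finset.sum_le_sum fun s _ => Finset.sum_le_sum fun t _ => ?_
        rw [abs_mul, abs_of_nonneg (mul_nonneg (hp0 s) (hq0 t))]
        refine (mul_le_mul_of_nonneg_left (abs_two_mul_div_sub_le hr ha)
          (mul_nonneg (hp0 s) (hq0 t))).trans (le_of_eq ?_)
        ring
    _ = 2 / r * ((∑ s, p s * |average s - x|) + ∑ t, q t * |average t - y|) := by
        simp only [← Finset.mul_sum, Finset.sum_add_distrib, ← Finset.sum_mul, hp1, hq1, mul_one,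
          one_mul]
    _ ≤ 2 / r * (1 / M + 1 / M) := by gcongr
    _ = 4 / (r * M) := by
        have hM' : (M : ℝ) ≠ 0 := by exact_mod_cast hM.ne'
        field_simp
        norm_num

/-- The bias of a round of rDIPE on states in `CW`. -/
theorem abs_sum_roundProb_sub_cosine_le (hn : 0 < n) {ψ φ : Bits n → ℂ} (hψ : ψ ∈ CW n)
    (hφ : φ ∈ CW n) {M : ℕ} (hM : 0 < M) :
    |∑ r : Round n (M ^ 2), roundProb (pureState ψ) (pureState φ) r * roundValue r -
      cosine (pureState ψ) (pureState φ)| ≤ 4 * n / M := by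
  have hψ1 := CW_normalized hn hψ
  have hφ1 := CW_normalized hn hφ
  have hn' : (0 : ℝ) < n := by exact_mod_cast hn
  rw [sum_roundProb_mul, ← sum_bellDist_mul (star_CW hψ) (star_CW hφ) hψ1 hφ1,
    ← Finset.sum_sub_distrib]
  refine (Finset.abs_sum_le_sum_abs _ _).trans ?_
  -- The total label weight 1 is inserted to spread the bound over the labels and compare termwise.
  rw [← one_mul (4 * (n : ℝ) / M), ← sum_bellDist (star_CW hψ) (star_CW hφ) hψ1 hφ1, Finset.sum_mul]
  refine Finset.sum_le_sum fun a _ => ?_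
  have hw := bellDist_add_nonneg (star_CW hψ) (star_CW hφ) a
  rw [← mul_sub, abs_mul, abs_of_nonneg hw]
  have hle : ∀ {χ : Bits n → ℂ}, χ ∈ CW n → pauliExpect (pureState χ) a ≠ 0 →
      (1 / (n : ℝ)) ^ 2 ≤ pauliExpect (pureState χ) a ^ 2 := by
    intro χ hχ h0
    rw [← sq_abs (pauliExpect _ _)]
    exact pow_le_pow_left₀ (by positivity) (one_div_le_abs_pauliExpect hχ h0) 2
  -- The Lipschitz bound is unavailable at the origin, but such labels have probability zero;
  -- elsewhere `r = 1 / n` is admissible.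
  by_cases h0 : pauliExpect (pureState ψ) a = 0 ∧ pauliExpect (pureState φ) a = 0
  · rw [bellDist_pureState (star_CW hψ), bellDist_pureState (star_CW hφ), h0.1, h0.2]
    simp
  · refine mul_le_mul_of_nonneg_left ?_ hw
    have hr : (1 / (n : ℝ)) ^ 2 ≤
        pauliExpect (pureState ψ) a ^ 2 + pauliExpect (pureState φ) a ^ 2 := by
      by_cases h1 : pauliExpect (pureState ψ) a = 0
      · exact (hle hφ fun h => h0 ⟨h1, h⟩).trans (le_add_of_nonneg_left (sq_nonneg _))
      · exact (hle hψ h1).trans (le_add_of_nonneg_right (sq_nonneg _))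
    refine (abs_sum_roundValue_sub_le hψ1 hφ1 a (by positivity) hr hM).trans (le_of_eq ?_)
    field_simp

/-- The failure probability of rDIPE on states in `CW`. -/
theorem failureProb_le (hn : 0 < n) {ψ φ : Bits n → ℂ} (hψ : ψ ∈ CW n) (hφ : φ ∈ CW n)
    {ε t : ℝ} (ht : 0 ≤ t) (ht1 : t ≤ 1) (htε : 2 * t ≤ ε) {M N : ℕ} (hM : 0 < M) (hN : 0 < N)
    (hMt : 4 * n / M ≤ t) :
    failureProb (pureState ψ) (pureState φ) N (M ^ 2) ε ≤ 2 * Real.exp (-(N * t ^ 2 / 16)) := by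
  classical
  have hψ1 := CW_normalized hn hψ
  have hφ1 := CW_normalized hn hφ
  have hb := (abs_sum_roundProb_sub_cosine_le hn hψ hφ hM).trans hMt
  have h := chernoff (p := roundProb (pureState ψ) (pureState φ) (N₂ := M ^ 2))
    (X := roundValue) (roundProb_nonneg (star_CW hψ) (star_CW hφ))
    (sum_roundProb (star_CW hψ) (star_CW hφ) hψ1 hφ1 _)
    (fun r => abs_two_mul_div_le_one _ _) ht ht1 hN
    (fun ω => ε < |estimator (pureState ψ) (pureState φ) ω - cosine (pureState ψ) (pureState φ)|)
    (by
      intro ω hω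
      rw [estimator_pureState hψ1 hφ1] at hω
      -- A miss by more than `ε ≥ 2 * t` with bias at most `t` forces a fluctuation of at least `t`.
      have := abs_sub_le (1 / (N : ℝ) * ∑ i, roundValue (ω i))
        (∑ r : Round n (M ^ 2), roundProb (pureState ψ) (pureState φ) r * roundValue r)
        (cosine (pureState ψ) (pureState φ))
      linarith)
  refine le_trans (le_of_eq ?_) h
  unfold failureProb runProb
  exact Finset.sum_congr rfl fun ω _ => by congr

end CrossDevice

/-! ### Choice of the sample sizes -/

open CrossDevice in
theorem proposition1 (ρ σ : (n : ℕ) → CrossDevice.Op n)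
    (hρ : ∀ n : ℕ, 0 < n → ∃ ψ ∈ CrossDevice.CW n, ρ n = CrossDevice.pureState ψ)
    (hσ : ∀ n : ℕ, 0 < n → ∃ ψ ∈ CrossDevice.CW n, σ n = CrossDevice.pureState ψ) :
    CrossDevice.Efficient ρ σ := by
  -- Put `K = 1 + 1 / ε` and `t = 1 / (2 * K)`; the summand 1 keeps `t ≤ 1` for large `ε`, and `2 *
  -- t ≤ ε`. Then `M ≥ 8 * n * K` gives bias at most `t`, and `N ≥ 64 * K ^ 2 * (δ + 1)` gives
  -- exponent at least `δ + 1`, whose extra 1 absorbs the prefactor `2 < e`. The final `+ 1` in the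
  -- first polynomial and in the base of the second pays for rounding up.
  refine ⟨fun _ ε δ => ⌈64 * (1 + 1 / ε) ^ 2 * (δ + 1)⌉₊,
    fun n ε _ => ⌈8 * n * (1 + 1 / ε)⌉₊ ^ 2,
    ⟨MvPolynomial.C 64 * (1 + MvPolynomial.X 1) ^ 2 * (MvPolynomial.X 2 + 1) + 1, ?_⟩,
    ⟨(MvPolynomial.C 8 * MvPolynomial.X 0 * (1 + MvPolynomial.X 1) + 1) ^ 2, ?_⟩, ?_⟩
  · intro n ε δ _ hε hδ
    simpa using (Nat.ceil_lt_add_one (by positivity : 0 ≤ 64 * (1 + 1 / ε) ^ 2 * (δ + 1))).le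
  · intro n ε δ _ hε hδ
    have h := (Nat.ceil_lt_add_one (by positivity : 0 ≤ 8 * (n : ℝ) * (1 + 1 / ε))).le
    simpa using pow_le_pow_left₀ (Nat.cast_nonneg _) h 2
  · intro n ε δ hn hε hδ
    have hn' : (0 : ℝ) < n := by exact_mod_cast hn
    have hN : 0 < ⌈64 * (1 + 1 / ε) ^ 2 * (δ + 1)⌉₊ := Nat.ceil_pos.mpr (by positivity)
    have hM : 0 < ⌈8 * (n : ℝ) * (1 + 1 / ε)⌉₊ := Nat.ceil_pos.mpr (by positivity)
    refine ⟨hN, pow_pos hM 2, ?_⟩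
    obtain ⟨ψ, hψ, hρψ⟩ := hρ n hn
    obtain ⟨φ, hφ, hσφ⟩ := hσ n hn
    rw [hρψ, hσφ]
    have hMle := Nat.le_ceil (8 * (n : ℝ) * (1 + 1 / ε))
    have hNle := Nat.le_ceil (64 * (1 + 1 / ε) ^ 2 * (δ + 1))
    set M := ⌈8 * (n : ℝ) * (1 + 1 / ε)⌉₊
    set N := ⌈64 * (1 + 1 / ε) ^ 2 * (δ + 1)⌉₊
    set K := 1 + 1 / ε with hK
    have hK1 : 1 ≤ K := le_add_of_nonneg_right (by positivity)
    have hKε : 1 ≤ K * ε := by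
      rw [hK, add_mul, one_div_mul_cancel hε.ne']
      linarith
    have hM' : (0 : ℝ) < M := by exact_mod_cast hM
    have hKpos : 0 < K := by linarith
    have h := failureProb_le hn hψ hφ (ε := ε) (t := 1 / (2 * K)) (by positivity)
      (by rw [div_le_one (by positivity)]; linarith)
      (by rw [← mul_div_assoc, div_le_iff₀ (by positivity)]; linarith) hM hN
      (by rw [div_le_div_iff₀ hM' (by positivity)]; linarith)
    refine h.trans_lt ?_
    have hexp : δ + 1 ≤ N * (1 / (2 * K)) ^ 2 / 16 := by
      rw [show (N : ℝ) * (1 / (2 * K)) ^ 2 / 16 = N / (64 * K ^ 2) by field_simp; norm_num,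
        le_div_iff₀ (by positivity)]
      linarith
    calc 2 * Real.exp (-(N * (1 / (2 * K)) ^ 2 / 16))
        ≤ 2 * Real.exp (-(δ + 1)) := by gcongr
      _ < Real.exp 1 * Real.exp (-(δ + 1)) := by
          have := Real.exp_one_gt_d9
          gcongr
          linarith
      _ = Real.exp (-δ) := by rw [← Real.exp_add]; ring_nf
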